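/- **Setting.** Let $n,d\ge 1$ and let $f_1,\dots,f_n:\mathbb R^d\to\mathbb R$ be twice continuously differentiable. Let $\mu>0$, $L$ and $\tilde L$ be real constants such that, for all $i\in\{1,\dots,n\}$ and all $x,y\in\mathbb R^d$, $$\tfrac{\mu}{2}\|y-x\|^2\le f_i(y)-f_i(x)-\langle\nabla f_i(x),y-x\rangle\le\tfrac{L}{2}\|y-x\|^2,\qquad \|\nabla^2f_i(y)-\nabla^2f_i(x)\|\le\tilde L\|y-x\|$$ (Euclidean norm for vectors, spectral norm for matrices). Let $x^\star$ be the minimizer of $\frac1n\sum_{i=1}^nf_i$ and put $M=\tilde L\mu^{-3/2}$. For matrices $B,K\in\mathbb R^{d\times d}$ and $u\in\mathbb R^d$ let $$\mathrm{BFGS}(B,K,u)=B-\frac{Buu^{\mathsf T}B}{\langle u,Bu\rangle}+\frac{Kuu^{\mathsf T}K}{\langle u,Ku\rangle},$$ with $\mathrm{BFGS}(B,K,0)=B$. A greedy vector $\bar u(B,K)$ is a standard basis vector that maximizes $\langle e,Be\rangle/\langle e,Ke\rangle$ over the standard basis vectors $e$ (ties are broken arbitrarily). Let $\sigma(B,K)=\mathrm{Tr}(K^{-1}(B-K))$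 for symmetric $B$ and symmetric invertible $K$. **SIQN (Sharpened Incremental Quasi-Newton).** Start from $x^0\in\mathbb R^d$, $z_i^0=x^0$ and matrices $B_i^0$ with $B_i^0\succeq\nabla^2f_i(x^0)$ for all $i$. For $t=1,2,\dots$, with $i_t=1+(t-1)\bmod n$: $$x^t=\Big(\sum_{i=1}^nB_i^{t-1}\Big)^{-1}\sum_{i=1}^n\big(B_i^{t-1}z_i^{t-1}-\nabla f_i(z_i^{t-1})\big);$$ $z_{i_t}^t=x^t$; $z_j^t=z_j^{t-1}$ and $B_j^t=B_j^{t-1}$ for $j\ne i_t$; and, with $s=z_{i_t}^t-z_{i_t}^{t-1}$, $\beta_t=\frac M2\sqrt{\langle s,\nabla^2f_{i_t}(z_{i_t}^{t-1})s\rangle}$ and $K^t=\int_0^1\nabla^2f_{i_t}(z_{i_t}^{t-1}+\tau s)\,d\tau$, $$Q^t=\mathrm{BFGS}\big((1+\beta_t)^2B_{i_t}^{t-1},(1+\beta_t)K^t,s\big),\qquad B_{i_t}^t=\mathrm{BFGS}\big(Q^t,\nabla^2f_{i_t}(z_{i_t}^t),\bar u(Q^t,\nabla^2f_{i_t}(z_{i_t}^t))\big).$$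 **Lemma (superlinear rate of SIQN).** For every $\rho$ with $0<\rho<1-\frac{\mu}{dL}$ there exist constants $\epsilon>0$ and $\sigma_0>0$ such that for every run of SIQN with $\|x^0-x^\star\|\le\epsilon$ and $\sigma(B_i^0,\nabla^2f_i(x^0))\le\sigma_0$ for all $i$, there is a sequence $(\zeta^k)_{k\ge0}$ of real numbers ($k$ is an index) with $$\|x^t-x^\star\|\le\zeta^{\lfloor (t-1)/n\rfloor}\quad\text{for all }t\ge1,\qquad \zeta^k\le\epsilon\Big(1-\frac{\mu}{dL}\Big)^{\frac{(k+1)(k+2)}{2}}\quad\text{for all }k\ge0.$$ -/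

import Mathlib

open scoped Matrix

namespace SIQN

/-- The space `ℝᵈ` with the Euclidean norm. -/
abbrev Vec (d : ℕ) := EuclideanSpace ℝ (Fin d)

/-- Real `d × d` matrices. -/
abbrev Mat (d : ℕ) := Matrix (Fin d) (Fin d) ℝ

/-- The Hessian matrix `∇²f(x)`: the Jacobian matrix of the gradient of `f` at `x`. -/
noncomputable def hessian {d : ℕ} (f : Vec d → ℝ) (x : Vec d) : Mat d :=
  Matrix.of fun i j => (fderiv ℝ (gradient f) x (EuclideanSpace.single j 1)) i

/-- The spectral norm of a matrix: its operator norm for the Euclidean norm. -/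
noncomputable def specNorm {d : ℕ} (A : Mat d) : ℝ :=
  ‖Matrix.toEuclideanCLM (n := Fin d) (𝕜 := ℝ) A‖

/-- `f` is `μ`-strongly convex and `L`-smooth. -/
def StronglyConvexSmooth {d : ℕ} (μ L : ℝ) (f : Vec d → ℝ) : Prop :=
  ∀ x y : Vec d,
    μ / 2 * ‖y - x‖ ^ 2 ≤ f y - f x - inner ℝ (gradient f x) (y - x) ∧
      f y - f x - inner ℝ (gradient f x) (y - x) ≤ L / 2 * ‖y - x‖ ^ 2

/-- The Hessian of `f` is `Lt`-Lipschitz continuous for the spectral norm. -/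
def HessianLipschitz {d : ℕ} (Lt : ℝ) (f : Vec d → ℝ) : Prop :=
  ∀ x y : Vec d, specNorm (hessian f y - hessian f x) ≤ Lt * ‖y - x‖

/-- The quadratic form `⟨u, A u⟩`. -/
def quadForm {d : ℕ} (A : Mat d) (u : Fin d → ℝ) : ℝ := u ⬝ᵥ (A *ᵥ u)

/-- The local norm `‖y‖_x = √⟨y, ∇²f(x) y⟩`. -/
noncomputable def localNorm {d : ℕ} (f : Vec d → ℝ) (x y : Vec d) : ℝ :=
  √(quadForm (hessian f x) y.ofLp)

/-- The generalized BFGS update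
`B - B u uᵀ B / ⟨u, B u⟩ + K u uᵀ K / ⟨u, K u⟩`.
For `u = 0` it is `B`, by the convention `0 / 0 = 0`. -/
noncomputable def bfgs {d : ℕ} (B K : Mat d) (u : Fin d → ℝ) : Mat d :=
  B - (quadForm B u)⁻¹ • Matrix.vecMulVec (B *ᵥ u) (u ᵥ* B)
    + (quadForm K u)⁻¹ • Matrix.vecMulVec (K *ᵥ u) (u ᵥ* K)

/-- `u` is a greedy vector for `(B, K)`: a standard basis vector that maximizes
`⟨e, B e⟩ / ⟨e, K e⟩` over the standard basis vectors `e`. -/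
def IsGreedyVector {d : ℕ} (B K : Mat d) (u : Fin d → ℝ) : Prop :=
  ∃ k : Fin d, u = Pi.single k 1 ∧
    ∀ j : Fin d, quadForm B (Pi.single j 1) / quadForm K (Pi.single j 1) ≤
      quadForm B u / quadForm K u

/-- The approximation error `σ(B, K) = ⟨K⁻¹, B - K⟩`, where `⟨X, Y⟩ = Tr(Xᵀ Y)`. -/
noncomputable def sigmaErr {d : ℕ} (B K : Mat d) : ℝ :=
  ((K⁻¹)ᵀ * (B - K)).trace

/-- The averaged Hessian `∫₀¹ ∇²f(a + τ (b - a)) dτ`, taken entry by entry. -/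
noncomputable def avgHessian {d : ℕ} (f : Vec d → ℝ) (a b : Vec d) : Mat d :=
  Matrix.of fun i j => ∫ τ in (0 : ℝ)..1, hessian f (a + τ • (b - a)) i j

/-- `B'` is obtained from `B` by a sharpened update for `f`, as the stored point moves from
`a` to `b`: a classical BFGS update after the correction by
`β = (M / 2) ‖b - a‖_a`, followed by a greedy BFGS update. -/
def SharpenedUpdate {d : ℕ} (M : ℝ) (f : Vec d → ℝ) (a b : Vec d) (B B' : Mat d) : Prop :=
  ∃ (β : ℝ) (Q : Mat d) (u : Fin d → ℝ),
    β = M / 2 * localNorm f a (b - a) ∧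
    Q = bfgs ((1 + β) ^ 2 • B) ((1 + β) • avgHessian f a b) (b - a).ofLp ∧
    IsGreedyVector Q (hessian f b) u ∧
    B' = bfgs Q (hessian f b) u

/-- `x t`, `z t i`, `B t i` are the iterates, stored points and Hessian approximations of a run
of SIQN on `f 0, …, f (n - 1)` with correction parameter `M`. The indices are counted from `0`,
so that iteration `t + 1` updates the index `t % n`. -/
structure IsRun {n d : ℕ} (M : ℝ) (f : Fin n → Vec d → ℝ)
    (x : ℕ → Vec d) (z : ℕ → Fin n → Vec d) (B : ℕ → Fin n → Mat d) : Prop where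
  z_init : ∀ i, z 0 i = x 0
  B_init : ∀ i, (B 0 i - hessian (f i) (z 0 i)).PosSemidef
  x_step : ∀ t, x (t + 1) =
    WithLp.toLp 2 ((∑ i, B t i)⁻¹ *ᵥ
      (∑ i, (B t i *ᵥ (z t i).ofLp - (gradient (f i) (z t i)).ofLp)))
  z_active : ∀ t (i : Fin n), (i : ℕ) = t % n → z (t + 1) i = x (t + 1)
  B_active : ∀ t (i : Fin n), (i : ℕ) = t % n →
    SharpenedUpdate M (f i) (z t i) (z (t + 1) i) (B t i) (B (t + 1) i)
  z_other : ∀ t (i : Fin n), (i : ℕ) ≠ t % n → z (t + 1) i = z t i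
  B_other : ∀ t (i : Fin n), (i : ℕ) ≠ t % n → B (t + 1) i = B t i

end SIQN

/-!
A BFGS update of `B` towards `K` deflates `B` in the direction `u` and adds the part of `K` lost in
its own deflation. Deflation is monotone in the Loewner order, so an update keeps `B` above `K`,
and it does not increase `Tr (K⁻¹ B)`. The greedy direction captures at least the average of the
diagonal of `B - K`, hence contracts `σ` by the factor `r = 1 - μ / (d L)`. The factors `1 + β`
compensate for the change of the Hessian when the stored point moves: they keep the approximations
above the Hessians and perturb `σ` by at most a multiple of the distance moved.

By the secant equation, `μ ‖x - x⋆‖ ≤ (L s + Lt e / 2) e` for the new point `x`, where `e` and `s`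
bound the distances of the stored points to the minimizer `x⋆` and the errors `σ`. While `x`
converges at least linearly, the perturbations of `σ` are summable, so that `σ` decays like `r ^ k`
in the number `k` of sweeps. Then the `k`-th sweep contracts the distance to the minimizer by
`r ^ k`, and the product of these factors is the superlinear bound.
-/

namespace SIQN

open Filter Matrix MeasureTheory Set Topology
open scoped MatrixOrder

section Loewner

variable {m : Type*} {A B C : Matrix m m ℝ}

lemma posDef_of_le (hA : A.PosDef) (h : A ≤ B) : B.PosDef := by
  simpa only [add_sub_cancel] using hA.add_posSemidef (Matrix.le_iff.1 h)

lemma posDef_of_smul_one_le [DecidableEq m] {c : ℝ} (hc : 0 < c)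
    (h : c • (1 : Matrix m m ℝ) ≤ A) : A.PosDef :=
  posDef_of_le (PosDef.one.smul hc) h

lemma isSymm_of_posSemidef (hA : A.PosSemidef) : A.IsSymm :=
  isHermitian_iff_isSymm.1 hA.isHermitian

variable [Fintype m]

lemma inv_mul_self_of_posDef [DecidableEq m] (hA : A.PosDef) : A⁻¹ * A = 1 :=
  nonsing_inv_mul _ ((isUnit_iff_isUnit_det A).1 hA.isUnit)

lemma mul_inv_self_of_posDef [DecidableEq m] (hA : A.PosDef) : A * A⁻¹ = 1 :=
  mul_nonsing_inv _ ((isUnit_iff_isUnit_det A).1 hA.isUnit)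

lemma inv_smul_of_posDef [DecidableEq m] {c : ℝ} (hc : 0 < c) (hA : A.PosDef) :
    (c • A)⁻¹ = c⁻¹ • A⁻¹ :=
  inv_smul' A (Units.mk0 c hc.ne') ((isUnit_iff_isUnit_det A).1 hA.isUnit)

lemma inv_le_inv_of_le [DecidableEq m] (hA : A.PosDef) (h : A ≤ B) : B⁻¹ ≤ A⁻¹ := by
  have hB := posDef_of_le hA h
  have := hB.isUnit.invertible
  have := hA.inv.isUnit.invertible
  -- `B - A` and `A⁻¹ - B⁻¹` are the two Schur complements of the block matrix `[B, 1; 1, A⁻¹]`.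
  have hblock : (fromBlocks B 1 1ᴴ A⁻¹).PosSemidef := by
    rw [hA.inv.fromBlocks₂₂, nonsing_inv_nonsing_inv A ((isUnit_iff_isUnit_det A).1 hA.isUnit)]
    simpa [Matrix.le_iff] using h
  rw [hB.fromBlocks₁₁] at hblock
  simpa [Matrix.le_iff] using hblock

lemma trace_mul_nonneg (hA : 0 ≤ A) (hB : 0 ≤ B) : 0 ≤ (A * B).trace := by
  classical
  obtain ⟨R, rfl⟩ := CStarAlgebra.nonneg_iff_eq_star_mul_self.1 hB
  rw [← Matrix.mul_assoc, trace_mul_comm, ← Matrix.mul_assoc]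
  exact (hA.posSemidef.mul_mul_conjTranspose_same R).trace_nonneg

lemma trace_mul_le_trace_mul (hAB : A ≤ B) (hC : 0 ≤ C) : (A * C).trace ≤ (B * C).trace := by
  rw [← sub_nonneg, ← trace_sub, ← Matrix.sub_mul]
  exact trace_mul_nonneg (sub_nonneg.2 hAB) hC

lemma sq_dotProduct_mulVec_le (hA : A.PosSemidef) (v w : m → ℝ) :
    (v ⬝ᵥ A *ᵥ w) ^ 2 ≤ (v ⬝ᵥ A *ᵥ v) * (w ⬝ᵥ A *ᵥ w) := by
  classical
  have h := (Matrix.toBilin' A).apply_sq_le_of_symm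
    (fun x => by simpa [toBilin'_apply'] using hA.dotProduct_mulVec_nonneg x)
    (LinearMap.BilinForm.isSymm_iff.1 (isSymm_toBilin'_iff_isSymm.2 (isSymm_of_posSemidef hA))) v w
  simpa [toBilin'_apply'] using h

end Loewner

section QuadForm

variable {d : ℕ} {A B : Mat d}

lemma quadForm_sub (A B : Mat d) (v : Fin d → ℝ) :
    quadForm (A - B) v = quadForm A v - quadForm B v := by
  simp only [quadForm, sub_mulVec, dotProduct_sub]

lemma quadForm_smul (c : ℝ) (A : Mat d) (v : Fin d → ℝ) :
    quadForm (c • A) v = c * quadForm A v := by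
  simp only [quadForm, smul_mulVec, dotProduct_smul, smul_eq_mul]

lemma quadForm_single (A : Mat d) (j : Fin d) : quadForm A (Pi.single j 1) = A j j := by
  simp [quadForm]

lemma quadForm_nonneg (hA : A.PosSemidef) (v : Fin d → ℝ) : 0 ≤ quadForm A v := by
  simpa only [quadForm, star_trivial] using hA.dotProduct_mulVec_nonneg v

lemma quadForm_pos (hA : A.PosDef) {v : Fin d → ℝ} (hv : v ≠ 0) : 0 < quadForm A v := by
  simpa only [quadForm, star_trivial] using hA.dotProduct_mulVec_pos hv

lemma quadForm_le_quadForm (h : A ≤ B) (v : Fin d → ℝ) : quadForm A v ≤ quadForm B v := by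
  rw [← sub_nonneg, ← quadForm_sub]
  exact quadForm_nonneg (Matrix.le_iff.1 h) v

lemma le_of_quadForm_le (hA : A.IsSymm) (hB : B.IsSymm)
    (h : ∀ v, quadForm A v ≤ quadForm B v) : A ≤ B :=
  Matrix.le_iff.2 <| .of_dotProduct_mulVec_nonneg (isHermitian_iff_isSymm.2 (hB.sub hA)) fun v => by
    simpa only [star_trivial, quadForm, sub_mulVec, dotProduct_sub, sub_nonneg] using h v

lemma vecMul_eq_mulVec (hA : A.IsSymm) (v : Fin d → ℝ) : v ᵥ* A = A *ᵥ v := by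
  rw [← mulVec_transpose, hA.eq]

lemma dotProduct_mulVec_comm (hA : A.IsSymm) (v w : Fin d → ℝ) :
    v ⬝ᵥ A *ᵥ w = w ⬝ᵥ A *ᵥ v := by
  rw [dotProduct_mulVec, vecMul_eq_mulVec hA, dotProduct_comm]

lemma quadForm_sub_smul (hA : A.IsSymm) (v u : Fin d → ℝ) (t : ℝ) :
    quadForm A (v - t • u) =
      quadForm A v - 2 * t * (u ⬝ᵥ A *ᵥ v) + t ^ 2 * quadForm A u := by
  simp only [quadForm, mulVec_sub, mulVec_smul, sub_dotProduct, dotProduct_sub, smul_dotProduct,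
    dotProduct_smul, smul_eq_mul, dotProduct_mulVec_comm hA v u]
  ring

end QuadForm

section BFGS

variable {d : ℕ} {A B H H' K P : Mat d} {u : Fin d → ℝ} {c : ℝ}

/-- The matrix `A - A u uᵀ A / ⟨u, A u⟩`, obtained from `A` by removing the direction `u`. A BFGS
update replaces the part of `B` outside its deflation by the corresponding part of `K`. -/
noncomputable def deflate (A : Mat d) (u : Fin d → ℝ) : Mat d :=
  A - (quadForm A u)⁻¹ • vecMulVec (A *ᵥ u) (u ᵥ* A)

lemma bfgs_eq_deflate_add (B K : Mat d) (u : Fin d → ℝ) :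
    bfgs B K u = deflate B u + (K - deflate K u) := by
  rw [bfgs, deflate, deflate, sub_sub_cancel]

lemma deflate_isSymm (hA : A.IsSymm) (u : Fin d → ℝ) : (deflate A u).IsSymm := by
  rw [deflate, vecMul_eq_mulVec hA]
  exact hA.sub (IsSymm.smul (transpose_vecMulVec _ _) _)

lemma quadForm_deflate (hA : A.IsSymm) (u v : Fin d → ℝ) :
    quadForm (deflate A u) v = quadForm A v - (u ⬝ᵥ A *ᵥ v) ^ 2 / quadForm A u := by
  have hrank : quadForm (vecMulVec (A *ᵥ u) (u ᵥ* A)) v = (u ⬝ᵥ A *ᵥ v) ^ 2 := by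
    rw [quadForm, vecMulVec_mulVec, ← dotProduct_mulVec, op_smul_eq_smul, dotProduct_smul,
      dotProduct_mulVec_comm hA, smul_eq_mul, sq]
  rw [deflate, quadForm_sub, quadForm_smul, hrank, inv_mul_eq_div]

lemma quadForm_deflate_le (hA : A.PosSemidef) (u v : Fin d → ℝ) (t : ℝ) :
    quadForm (deflate A u) v ≤ quadForm A (v - t • u) := by
  have hsymm := isSymm_of_posSemidef hA
  have hcs : (u ⬝ᵥ A *ᵥ v) ^ 2 ≤ quadForm A u * quadForm A v := sq_dotProduct_mulVec_le hA u v
  rw [quadForm_deflate hsymm, quadForm_sub_smul hsymm]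
  rcases (quadForm_nonneg hA u).eq_or_lt with hu | hu
  · rw [← hu, zero_mul, sq_nonpos_iff] at hcs
    simp [hcs, ← hu]
  · have := sq_nonneg (t * quadForm A u - u ⬝ᵥ A *ᵥ v)
    field_simp
    nlinarith

lemma quadForm_deflate_eq (hA : A.IsSymm) (u v : Fin d → ℝ) :
    quadForm (deflate A u) v = quadForm A (v - ((u ⬝ᵥ A *ᵥ v) / quadForm A u) • u) := by
  rw [quadForm_deflate hA, quadForm_sub_smul hA]
  rcases eq_or_ne (quadForm A u) 0 with hu | hu
  · simp [hu]
  · field_simp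
    ring

/-- `⟨v, deflate A u v⟩` is the minimum of `⟨v - t u, A (v - t u)⟩` over `t`. -/
lemma deflate_le_deflate (hA : A.PosSemidef) (h : A ≤ B) (u : Fin d → ℝ) :
    deflate A u ≤ deflate B u := by
  have hB : B.PosSemidef := (hA.nonneg.trans h).posSemidef
  have hBs := isSymm_of_posSemidef hB
  refine le_of_quadForm_le (deflate_isSymm (isSymm_of_posSemidef hA) u)
    (deflate_isSymm hBs u) fun v => ?_
  rw [quadForm_deflate_eq hBs]
  exact (quadForm_deflate_le hA u v _).trans (quadForm_le_quadForm h _)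

lemma le_bfgs (hK : K.PosSemidef) (h : K ≤ B) (u : Fin d → ℝ) : K ≤ bfgs B K u := by
  calc K = deflate K u + (K - deflate K u) := (add_sub_cancel _ _).symm
    _ ≤ deflate B u + (K - deflate K u) := by gcongr; exact deflate_le_deflate hK h u
    _ = bfgs B K u := (bfgs_eq_deflate_add B K u).symm

lemma bfgs_zero (B K : Mat d) : bfgs B K 0 = B := by
  simp [bfgs]

lemma sq_dotProduct_le (hK : K.PosDef) (v w : Fin d → ℝ) :
    (v ⬝ᵥ w) ^ 2 ≤ quadForm K⁻¹ v * quadForm K w := by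
  have h := sq_dotProduct_mulVec_le hK.inv.posSemidef v (K *ᵥ w)
  rwa [mulVec_mulVec, inv_mul_self_of_posDef hK, one_mulVec, dotProduct_comm (K *ᵥ w)] at h

lemma trace_inv_mul_deflate (hA : A.IsSymm) (K : Mat d) (u : Fin d → ℝ) :
    (K⁻¹ * deflate A u).trace = (K⁻¹ * A).trace - quadForm K⁻¹ (A *ᵥ u) / quadForm A u := by
  rw [deflate, Matrix.mul_sub, Matrix.mul_smul, trace_sub, trace_smul, vecMul_eq_mulVec hA,
    mul_vecMulVec, trace_vecMulVec, dotProduct_comm, smul_eq_mul, ← quadForm, inv_mul_eq_div]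

lemma trace_inv_mul_deflate_le (hA : A.PosSemidef) (hK : K.PosDef) (u : Fin d → ℝ) :
    (K⁻¹ * deflate A u).trace ≤ (K⁻¹ * A).trace - quadForm A u / quadForm K u := by
  rw [trace_inv_mul_deflate (isSymm_of_posSemidef hA), sub_le_sub_iff_left]
  have hcs := sq_dotProduct_le hK (A *ᵥ u) u
  rw [dotProduct_comm, ← quadForm] at hcs
  rcases (quadForm_nonneg hA u).eq_or_lt with hu | hu
  · simp [← hu]
  · refine div_le_of_le_mul₀ (quadForm_nonneg hK.posSemidef u) (div_nonneg
      (quadForm_nonneg hK.inv.posSemidef _) hu.le) ?_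
    rw [div_mul_eq_mul_div, le_div_iff₀ hu]
    linarith

lemma trace_inv_mul_deflate_self (hK : K.PosDef) (hu : u ≠ 0) :
    (K⁻¹ * deflate K u).trace = (K⁻¹ * K).trace - 1 := by
  have hKu : quadForm K⁻¹ (K *ᵥ u) = quadForm K u := by
    rw [quadForm, mulVec_mulVec, inv_mul_self_of_posDef hK, one_mulVec, dotProduct_comm, quadForm]
  rw [trace_inv_mul_deflate (isSymm_of_posSemidef hK.posSemidef), hKu,
    div_self (quadForm_pos hK hu).ne']

lemma trace_inv_mul_bfgs_le (hB : B.PosSemidef) (hK : K.PosDef) (hu : u ≠ 0) :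
    (K⁻¹ * bfgs B K u).trace ≤ (K⁻¹ * B).trace - quadForm B u / quadForm K u + 1 := by
  rw [bfgs_eq_deflate_add, Matrix.mul_add, Matrix.mul_sub, trace_add, trace_sub,
    trace_inv_mul_deflate_self hK hu, sub_sub_cancel]
  gcongr
  exact trace_inv_mul_deflate_le hB hK u

lemma trace_inv_mul_bfgs_le_trace (hK : K.PosDef) (h : K ≤ B) (u : Fin d → ℝ) :
    (K⁻¹ * bfgs B K u).trace ≤ (K⁻¹ * B).trace := by
  rcases eq_or_ne u 0 with rfl | hu
  · rw [bfgs_zero]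
  have hdrop := trace_inv_mul_bfgs_le (posDef_of_le hK h).posSemidef hK hu
  have hratio : 1 ≤ quadForm B u / quadForm K u :=
    (one_le_div (quadForm_pos hK hu)).2 (quadForm_le_quadForm h u)
  linarith

/-- The update towards `P` costs nothing when measured against `P`; only the passage from the
reference `H` to `P` and on to `H'` does. -/
lemma trace_inv_mul_bfgs_le_mul (hH : H.PosDef) (hH' : H'.PosDef) (hHP : H ≤ P) (hPA : P ≤ A)
    (hc : 0 < c) (hPH' : P ≤ c • H') (u : Fin d → ℝ) :
    (H'⁻¹ * bfgs A P u).trace ≤ c * (H⁻¹ * A).trace := by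
  have hP : P.PosDef := posDef_of_le hH hHP
  have hQ : 0 ≤ bfgs A P u := hP.posSemidef.nonneg.trans (le_bfgs hP.posSemidef hPA u)
  have hinv : H'⁻¹ ≤ c • P⁻¹ := by
    rw [← inv_smul_le_iff_of_pos hc, ← inv_smul_of_posDef hc hH']
    exact inv_le_inv_of_le hP hPH'
  calc (H'⁻¹ * bfgs A P u).trace ≤ ((c • P⁻¹) * bfgs A P u).trace := trace_mul_le_trace_mul hinv hQ
    _ = c * (P⁻¹ * bfgs A P u).trace := by rw [Matrix.smul_mul, trace_smul, smul_eq_mul]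
    _ ≤ c * (P⁻¹ * A).trace := by gcongr; exact trace_inv_mul_bfgs_le_trace hP hPA u
    _ ≤ c * (H⁻¹ * A).trace := by
        gcongr
        exact trace_mul_le_trace_mul (inv_le_inv_of_le hH hHP)
          (hP.posSemidef.nonneg.trans hPA)

end BFGS

section SigmaErr

variable {d : ℕ} {B K : Mat d} {u : Fin d → ℝ} {μ L : ℝ}

lemma sigmaErr_eq (hK : K.PosDef) : sigmaErr B K = (K⁻¹ * B).trace - d := by
  rw [sigmaErr, (isSymm_of_posSemidef hK.inv.posSemidef).eq, Matrix.mul_sub, trace_sub,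
    inv_mul_self_of_posDef hK, trace_one, Fintype.card_fin]

lemma trace_sub_le_mul_sigmaErr (hL : 0 < L) (hK : K.PosDef) (hKL : K ≤ L • 1) (h : K ≤ B) :
    (B - K).trace ≤ L * sigmaErr B K := by
  have hinv : L⁻¹ • 1 ≤ K⁻¹ := by
    rw [← inv_one, ← inv_smul_of_posDef hL PosDef.one]
    exact inv_le_inv_of_le hK hKL
  have htrace := trace_mul_le_trace_mul hinv (sub_nonneg.2 h)
  rw [Matrix.smul_mul, Matrix.one_mul, trace_smul, smul_eq_mul, inv_mul_le_iff₀ hL] at htrace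
  rwa [sigmaErr, (isSymm_of_posSemidef hK.inv.posSemidef).eq]

lemma mul_sigmaErr_le_trace_sub (hμ : 0 < μ) (hμK : μ • 1 ≤ K) (h : K ≤ B) :
    μ * sigmaErr B K ≤ (B - K).trace := by
  have hinv : K⁻¹ ≤ μ⁻¹ • 1 := by
    rw [← inv_one, ← inv_smul_of_posDef hμ PosDef.one]
    exact inv_le_inv_of_le (PosDef.one.smul hμ) hμK
  have htrace := trace_mul_le_trace_mul hinv (sub_nonneg.2 h)
  rw [Matrix.smul_mul, Matrix.one_mul, trace_smul, smul_eq_mul, le_inv_mul_iff₀ hμ] at htrace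
  rwa [sigmaErr, (isSymm_of_posSemidef (posDef_of_smul_one_le hμ hμK).inv.posSemidef).eq]

lemma trace_sub_le_of_isGreedyVector (hL : 0 < L) (hK : K.PosDef) (hKL : K ≤ L • 1) (h : K ≤ B)
    (hu : IsGreedyVector B K u) :
    (B - K).trace ≤ d * L * (quadForm B u / quadForm K u - 1) := by
  obtain ⟨k, rfl, hmax⟩ := hu
  set g := quadForm B (Pi.single k 1) / quadForm K (Pi.single k 1) - 1
  have hdiag (j : Fin d) : (B - K) j j ≤ L * g := by
    have hKj : 0 < K j j := hK.diag_pos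
    have hjL : K j j ≤ L := by
      simpa [quadForm_single] using quadForm_le_quadForm hKL (Pi.single j 1)
    have hjB : K j j ≤ B j j := by
      simpa only [quadForm_single] using quadForm_le_quadForm h (Pi.single j 1)
    have hratio : B j j / K j j - 1 ≤ g := by
      simpa only [quadForm_single, g] using sub_le_sub_right (hmax j) 1
    have hratio_nonneg : 0 ≤ B j j / K j j - 1 := sub_nonneg.2 ((one_le_div hKj).2 hjB)
    calc (B - K) j j = K j j * (B j j / K j j - 1) := by
          rw [Matrix.sub_apply]; field_simp
      _ ≤ L * g := mul_le_mul hjL hratio hratio_nonneg hL.le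
  calc (B - K).trace ≤ ∑ _j : Fin d, L * g := Finset.sum_le_sum fun j _ => hdiag j
    _ = d * L * g := by simp [mul_assoc]

/-- The factor `1 - μ / (d L)` by which a greedy BFGS update contracts `σ`. -/
noncomputable def contractionFactor (d : ℕ) (μ L : ℝ) : ℝ := 1 - μ / (d * L)

lemma sigmaErr_bfgs_le_of_isGreedyVector (hL : 0 < L) (hμ : 0 < μ) (hμK : μ • 1 ≤ K)
    (hKL : K ≤ L • 1) (h : K ≤ B) (hu : IsGreedyVector B K u) :
    sigmaErr (bfgs B K u) K ≤ contractionFactor d μ L * sigmaErr B K := by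
  have hK := posDef_of_smul_one_le hμ hμK
  obtain ⟨k, hk, -⟩ := id hu
  have hd : (0 : ℝ) < d := by exact_mod_cast k.pos
  have hu0 : u ≠ 0 := by simp [hk]
  have hdrop := trace_inv_mul_bfgs_le (posDef_of_le hK h).posSemidef hK hu0
  have hgain : μ / (d * L) * sigmaErr B K ≤ quadForm B u / quadForm K u - 1 := by
    rw [div_mul_eq_mul_div, div_le_iff₀' (by positivity)]
    exact (mul_sigmaErr_le_trace_sub hμ hμK h).trans (trace_sub_le_of_isGreedyVector hL hK hKL h hu)
  rw [sigmaErr_eq hK] at hgain ⊢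
  rw [sigmaErr_eq hK, contractionFactor]
  linarith

end SigmaErr

section SpecNorm

variable {d : ℕ} {A : Mat d} {c : ℝ}

/-- The linear map `v ↦ A v` of the Euclidean space `ℝᵈ`, whose operator norm is `specNorm A`. -/
noncomputable abbrev toCLM : Mat d ≃⋆ₐ[ℝ] (Vec d →L[ℝ] Vec d) := toEuclideanCLM

lemma quadForm_eq_inner (A : Mat d) (v : Vec d) : quadForm A v.ofLp = inner ℝ v (toCLM A v) :=
  (inner_toEuclideanCLM A v v).symm

lemma quadForm_smul_one (c : ℝ) (v : Vec d) : quadForm (c • 1) v.ofLp = c * ‖v‖ ^ 2 := by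
  rw [quadForm_smul, quadForm_eq_inner, map_one, one_apply_eq_self,
    real_inner_self_eq_norm_sq]

lemma smul_one_le (hA : A.IsSymm) (h : ∀ v, c * ‖v‖ ^ 2 ≤ inner ℝ v (toCLM A v)) : c • 1 ≤ A :=
  le_of_quadForm_le (isSymm_one.smul c) hA fun v => by
    simpa only [← quadForm_smul_one, ← quadForm_eq_inner] using h (WithLp.toLp 2 v)

lemma le_smul_one (hA : A.IsSymm) (h : ∀ v, inner ℝ v (toCLM A v) ≤ c * ‖v‖ ^ 2) : A ≤ c • 1 :=
  le_of_quadForm_le hA (isSymm_one.smul c) fun v => by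
    simpa only [← quadForm_smul_one, ← quadForm_eq_inner] using h (WithLp.toLp 2 v)

lemma le_specNorm_smul_one (hA : A.IsSymm) : A ≤ specNorm A • 1 :=
  le_smul_one hA fun v =>
    calc inner ℝ v (toCLM A v) ≤ ‖v‖ * ‖toCLM A v‖ := real_inner_le_norm _ _
      _ ≤ ‖v‖ * (specNorm A * ‖v‖) := by gcongr; exact (toCLM A).le_opNorm v
      _ = specNorm A * ‖v‖ ^ 2 := by ring

lemma specNorm_vecMulVec_le (v w : Vec d) :
    specNorm (vecMulVec v.ofLp w.ofLp) ≤ ‖v‖ * ‖w‖ := by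
  refine ContinuousLinearMap.opNorm_le_bound _ (by positivity) fun x => ?_
  have happly : toCLM (vecMulVec v.ofLp w.ofLp) x = inner ℝ w x • v := by
    ext i
    simp [vecMulVec_mulVec, EuclideanSpace.inner_eq_star_dotProduct, dotProduct_comm, mul_comm]
  rw [happly, norm_smul, mul_comm ‖v‖, mul_right_comm]
  gcongr
  exact norm_inner_le_norm w x

lemma specNorm_le_trace (hA : 0 ≤ A) : specNorm A ≤ A.trace := by
  obtain ⟨k, v, rfl⟩ := posSemidef_iff_eq_sum_vecMulVec.1 hA.posSemidef
  rw [specNorm, map_sum, trace_sum]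
  refine norm_sum_le_of_le _ fun i _ => (specNorm_vecMulVec_le (WithLp.toLp 2 (v i))
    (WithLp.toLp 2 (v i))).trans_eq ?_
  rw [← real_inner_self_eq_norm_mul_norm, EuclideanSpace.inner_eq_star_dotProduct, trace_vecMulVec]

lemma specNorm_inv_le (hc : 0 < c) (h : c • 1 ≤ A) : specNorm A⁻¹ ≤ c⁻¹ := by
  have hA := posDef_of_smul_one_le hc h
  refine ContinuousLinearMap.opNorm_le_bound _ (by positivity) fun v => ?_
  set w := toCLM A⁻¹ v
  have hAw : toCLM A w = v := by
    rw [← mul_apply_eq_comp, ← map_mul, mul_inv_self_of_posDef hA, map_one,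
      one_apply_eq_self]
  have hcw : c * ‖w‖ * ‖w‖ ≤ ‖v‖ * ‖w‖ :=
    calc c * ‖w‖ * ‖w‖ = quadForm (c • 1) w.ofLp := by rw [quadForm_smul_one]; ring
      _ ≤ quadForm A w.ofLp := quadForm_le_quadForm h _
      _ = inner ℝ w v := by rw [quadForm_eq_inner, hAw]
      _ ≤ ‖v‖ * ‖w‖ := (real_inner_le_norm w v).trans_eq (mul_comm _ _)
  rw [le_inv_mul_iff₀ hc]
  rcases (norm_nonneg w).eq_or_lt with hw | hw
  · simp [← hw]
  · exact le_of_mul_le_mul_right hcw hw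

end SpecNorm

section Hessian

lemma mul_norm_sq_le_inner_of_hasFDerivAt {E : Type*} [NormedAddCommGroup E]
    [InnerProductSpace ℝ E] {g : E → E} {g' : E →L[ℝ] E} {x : E} {c : ℝ}
    (hg : HasFDerivAt g g' x) (h : ∀ y, c * ‖y - x‖ ^ 2 ≤ inner ℝ (y - x) (g y - g x)) (v : E) :
    c * ‖v‖ ^ 2 ≤ inner ℝ v (g' v) := by
  have hlim : Tendsto (fun t : ℝ => inner ℝ v (t⁻¹ • (g (x + t • v) - g x)))
      (𝓝[>] 0) (𝓝 (inner ℝ v (g' v))) := by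
    simpa using tendsto_const_nhds.inner (hg.hasLineDerivAt v).tendsto_slope_zero_right
  refine ge_of_tendsto hlim (eventually_mem_nhdsWithin.mono fun t ht => ?_)
  have hmono := h (x + t • v)
  rw [add_sub_cancel_left, norm_smul, mul_pow, Real.norm_eq_abs, sq_abs, real_inner_smul_left]
    at hmono
  rw [real_inner_smul_right, le_inv_mul_iff₀ ht]
  refine le_of_mul_le_mul_left ?_ ht
  linarith

variable {d : ℕ} {f : Vec d → ℝ} {μ L Lt : ℝ}

lemma contDiff_gradient (hf : ContDiff ℝ 2 f) : ContDiff ℝ 1 (gradient f) :=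
  (InnerProductSpace.toDual ℝ (Vec d)).symm.toContinuousLinearEquiv.contDiff.comp
    (hf.fderiv_right (by norm_num))

lemma toCLM_hessian (f : Vec d → ℝ) (x : Vec d) :
    toCLM (hessian f x) = fderiv ℝ (gradient f) x := by
  refine ContinuousLinearMap.coe_injective ((EuclideanSpace.basisFun (Fin d) ℝ).toBasis.ext ?_)
  intro j
  ext i
  simp [hessian]

lemma hasFDerivAt_gradient (hf : ContDiff ℝ 2 f) (x : Vec d) :
    HasFDerivAt (gradient f) (toCLM (hessian f x)) x := by
  rw [toCLM_hessian]
  exact ((contDiff_gradient hf).differentiable one_ne_zero x).hasFDerivAt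

lemma continuous_toCLM_hessian (hf : ContDiff ℝ 2 f) : Continuous fun x => toCLM (hessian f x) := by
  simp only [toCLM_hessian]
  exact (contDiff_gradient hf).continuous_fderiv one_ne_zero

lemma inner_toCLM_hessian (hf : ContDiff ℝ 2 f) (x v w : Vec d) :
    inner ℝ w (toCLM (hessian f x) v) = fderiv ℝ (fderiv ℝ f) x v w := by
  have hgrad : HasFDerivAt (fun y => inner ℝ w (gradient f y))
      ((innerSL ℝ w).comp (toCLM (hessian f x))) x :=
    (innerSL ℝ w).hasFDerivAt.comp x (hasFDerivAt_gradient hf x)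
  have hfderiv : HasFDerivAt (fun y => fderiv ℝ f y w) ((fderiv ℝ (fderiv ℝ f) x).flip w) x := by
    have hdiff := (hf.fderiv_right (m := 1) (by norm_num)).differentiable one_ne_zero x
    simpa using hdiff.hasFDerivAt.clm_apply (hasFDerivAt_const w x)
  have heq (y : Vec d) : inner ℝ w (gradient f y) = fderiv ℝ f y w := by
    rw [real_inner_comm, inner_gradient_left]
  simp only [heq] at hgrad
  exact DFunLike.congr_fun (hgrad.unique hfderiv) v

lemma hessian_isSymm (hf : ContDiff ℝ 2 f) (x : Vec d) : (hessian f x).IsSymm := by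
  have hsymm : IsSymmSndFDerivAt ℝ f x := hf.contDiffAt.isSymmSndFDerivAt (by simp)
  have happly (i j : Fin d) : hessian f x i j =
      fderiv ℝ (fderiv ℝ f) x (EuclideanSpace.single j 1) (EuclideanSpace.single i 1) := by
    simp [← inner_toCLM_hessian hf, EuclideanSpace.inner_single_left]
  ext i j
  rw [transpose_apply, happly, happly, hsymm.eq]

lemma inner_sub_gradient_sub_mem_Icc (h : StronglyConvexSmooth μ L f) (x y : Vec d) :
    inner ℝ (y - x) (gradient f y - gradient f x) ∈ Icc (μ * ‖y - x‖ ^ 2) (L * ‖y - x‖ ^ 2) := by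
  have hxy := h x y
  have hyx := h y x
  rw [norm_sub_rev x y, ← neg_sub y x, inner_neg_right] at hyx
  rw [real_inner_comm, inner_sub_left]
  constructor <;> linarith [hxy.1, hxy.2, hyx.1, hyx.2]

lemma smul_one_le_hessian (hf : ContDiff ℝ 2 f) (h : StronglyConvexSmooth μ L f) (x : Vec d) :
    μ • 1 ≤ hessian f x :=
  smul_one_le (hessian_isSymm hf x) <| mul_norm_sq_le_inner_of_hasFDerivAt
    (hasFDerivAt_gradient hf x) fun y => (inner_sub_gradient_sub_mem_Icc h x y).1

lemma hessian_le_smul_one (hf : ContDiff ℝ 2 f) (h : StronglyConvexSmooth μ L f) (x : Vec d) :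
    hessian f x ≤ L • 1 := by
  refine le_smul_one (hessian_isSymm hf x) fun v => ?_
  have hneg := mul_norm_sq_le_inner_of_hasFDerivAt (c := -L) (hasFDerivAt_gradient hf x).neg
    (fun y => ?_) v
  · rw [_root_.neg_apply, inner_neg_right] at hneg
    linarith
  · rw [Pi.neg_apply, Pi.neg_apply, neg_sub_neg, ← neg_sub (gradient f y), inner_neg_right]
    linarith [(inner_sub_gradient_sub_mem_Icc h x y).2]

section Average

lemma avgHessian_comm (f : Vec d → ℝ) (a b : Vec d) : avgHessian f a b = avgHessian f b a := by
  ext i j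
  have := intervalIntegral.integral_comp_sub_left (a := 0) (b := 1)
    (fun τ : ℝ => hessian f (a + τ • (b - a)) i j) 1
  rw [sub_self, sub_zero] at this
  simp only [avgHessian, of_apply, ← this]
  congr! 3 with τ
  module

lemma avgHessian_isSymm (hf : ContDiff ℝ 2 f) (a b : Vec d) : (avgHessian f a b).IsSymm := by
  ext i j
  simp only [transpose_apply, avgHessian, of_apply, (hessian_isSymm hf _).apply i j]

lemma continuous_toCLM_hessian_segment (hf : ContDiff ℝ 2 f) (a b : Vec d) :
    Continuous fun τ : ℝ => toCLM (hessian f (a + τ • (b - a))) :=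
  (continuous_toCLM_hessian hf).comp (by fun_prop)

lemma toCLM_avgHessian (hf : ContDiff ℝ 2 f) (a b : Vec d) :
    toCLM (avgHessian f a b) = ∫ τ in (0 : ℝ)..1, toCLM (hessian f (a + τ • (b - a))) := by
  refine ContinuousLinearMap.coe_injective ((EuclideanSpace.basisFun (Fin d) ℝ).toBasis.ext ?_)
  intro j
  ext i
  have h := ((EuclideanSpace.proj i : Vec d →L[ℝ] ℝ).comp (ContinuousLinearMap.apply ℝ _
    (EuclideanSpace.single j 1))).intervalIntegral_comp_comm
      ((continuous_toCLM_hessian_segment hf a b).intervalIntegrable (μ := volume) 0 1)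
  simpa [avgHessian] using h

lemma toCLM_avgHessian_sub (hf : ContDiff ℝ 2 f) (a b : Vec d) :
    toCLM (avgHessian f a b) (b - a) = gradient f b - gradient f a := by
  have hline (τ : ℝ) : HasDerivAt (fun τ : ℝ => gradient f (a + τ • (b - a)))
      (toCLM (hessian f (a + τ • (b - a))) (b - a)) τ :=
    (hasFDerivAt_gradient hf _).comp_hasDerivAt τ
      (by simpa using ((hasDerivAt_id τ).smul_const (b - a)).const_add a)
  have hcont := continuous_toCLM_hessian_segment hf a b
  rw [toCLM_avgHessian hf,
    ContinuousLinearMap.intervalIntegral_apply (hcont.intervalIntegrable _ _),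
    intervalIntegral.integral_eq_sub_of_hasDerivAt (fun τ _ => hline τ)
      ((hcont.clm_apply continuous_const).intervalIntegrable _ _)]
  simp

lemma specNorm_avgHessian_sub_le (hf : ContDiff ℝ 2 f) (h : HessianLipschitz Lt f) (a b : Vec d) :
    specNorm (avgHessian f a b - hessian f a) ≤ Lt / 2 * ‖b - a‖ := by
  have hint := (continuous_toCLM_hessian_segment hf a b).intervalIntegrable (μ := volume) 0 1
  calc specNorm (avgHessian f a b - hessian f a)
      = ‖∫ τ in (0 : ℝ)..1, toCLM (hessian f (a + τ • (b - a)) - hessian f a)‖ := by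
        simp only [specNorm, map_sub, toCLM_avgHessian hf]
        rw [intervalIntegral.integral_sub hint intervalIntegrable_const]
        simp
    _ ≤ ∫ τ in (0 : ℝ)..1, τ * (Lt * ‖b - a‖) := by
        refine intervalIntegral.norm_integral_le_of_norm_le zero_le_one
          (.of_forall fun τ hτ => ?_) ((by fun_prop : Continuous _).intervalIntegrable _ _)
        refine (h a (a + τ • (b - a))).trans_eq ?_
        rw [add_sub_cancel_left, norm_smul, Real.norm_of_nonneg hτ.1.le]
        ring
    _ = Lt / 2 * ‖b - a‖ := by
        rw [intervalIntegral.integral_mul_const, integral_id]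
        ring

lemma smul_one_le_avgHessian (hf : ContDiff ℝ 2 f) (h : StronglyConvexSmooth μ L f) (a b : Vec d) :
    μ • 1 ≤ avgHessian f a b := by
  have hcont := continuous_toCLM_hessian_segment hf a b
  refine smul_one_le (avgHessian_isSymm hf a b) fun v => ?_
  calc μ * ‖v‖ ^ 2 = ∫ _τ in (0 : ℝ)..1, μ * ‖v‖ ^ 2 := by simp
    _ ≤ ∫ τ in (0 : ℝ)..1, inner ℝ v (toCLM (hessian f (a + τ • (b - a))) v) := by
        refine intervalIntegral.integral_mono_on zero_le_one intervalIntegrable_const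
          ((continuous_const.inner (hcont.clm_apply continuous_const)).intervalIntegrable _ _)
          fun τ _ => ?_
        rw [← quadForm_smul_one, ← quadForm_eq_inner]
        exact quadForm_le_quadForm (smul_one_le_hessian hf h _) _
    _ = inner ℝ v (toCLM (avgHessian f a b) v) := by
        rw [toCLM_avgHessian hf]
        exact ((innerSL ℝ v).comp (ContinuousLinearMap.apply ℝ _ v)).intervalIntegral_comp_comm
          (hcont.intervalIntegrable _ _)

end Average

end Hessian

section Regular

lemma StronglyConvexSmooth.le {d : ℕ} [Nontrivial (Vec d)] {f : Vec d → ℝ} {μ L : ℝ}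
    (h : StronglyConvexSmooth μ L f) : μ ≤ L := by
  obtain ⟨x, y, hxy⟩ := exists_pair_ne (Vec d)
  have hpos : 0 < ‖y - x‖ ^ 2 := pow_pos (norm_pos_iff.2 (sub_ne_zero.2 hxy.symm)) 2
  linarith [le_of_mul_le_mul_right ((h x y).1.trans (h x y).2) hpos]

lemma HessianLipschitz.nonneg {d : ℕ} [Nontrivial (Vec d)] {f : Vec d → ℝ} {Lt : ℝ}
    (h : HessianLipschitz Lt f) : 0 ≤ Lt := by
  obtain ⟨x, y, hxy⟩ := exists_pair_ne (Vec d)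
  exact nonneg_of_mul_nonneg_left ((norm_nonneg _).trans (h x y))
    (norm_pos_iff.2 (sub_ne_zero.2 hxy.symm))

/-- The standing assumptions on a component function, together with the signs of the constants. -/
structure IsRegular {d : ℕ} (μ L Lt : ℝ) (f : Vec d → ℝ) : Prop where
  mu_pos : 0 < μ
  L_pos : 0 < L
  Lt_nonneg : 0 ≤ Lt
  contDiff : ContDiff ℝ 2 f
  stronglyConvexSmooth : StronglyConvexSmooth μ L f
  hessianLipschitz : HessianLipschitz Lt f

/-- The parameter `β = (M / 2) ‖b - a‖_a` by which a sharpened update corrects the matrices when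
the stored point moves from `a` to `b`. -/
noncomputable def correction {d : ℕ} (M : ℝ) (f : Vec d → ℝ) (a b : Vec d) : ℝ :=
  M / 2 * localNorm f a (b - a)

/-- The constant `M` of the sharpened updates, which makes the `f i` strongly self-concordant. -/
noncomputable abbrev selfConcordance (μ Lt : ℝ) : ℝ := Lt * μ ^ (-(3 / 2) : ℝ)

/-- The constant relating the correction to distances: `β ≤ correctionGain / 2 * ‖b - a‖`. -/
noncomputable def correctionGain (μ L Lt : ℝ) : ℝ :=
  selfConcordance μ Lt * √L

lemma rpow_mul_sqrt_mul {μ : ℝ} (hμ : 0 < μ) : μ ^ (-(3 / 2) : ℝ) * √μ * μ = 1 := by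
  rw [Real.sqrt_eq_rpow, ← Real.rpow_add hμ, ← Real.rpow_add_one hμ.ne']
  norm_num

lemma le_one_add_smul_of_specNorm_sub_le {d : ℕ} {X Y : Mat d} {β μ : ℝ} (hμ : 0 < μ)
    (hX : X.IsSymm) (hY : Y.IsSymm) (hμY : μ • 1 ≤ Y) (h : specNorm (X - Y) ≤ β * μ) :
    X ≤ (1 + β) • Y := by
  have hβ : 0 ≤ β := nonneg_of_mul_nonneg_left ((norm_nonneg _).trans h) hμ
  rw [add_smul, one_smul, ← sub_le_iff_le_add']
  calc X - Y ≤ specNorm (X - Y) • 1 := le_specNorm_smul_one (hX.sub hY)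
    _ ≤ (β * μ) • 1 := smul_le_smul_of_nonneg_right h PosSemidef.one.nonneg
    _ = β • μ • 1 := mul_smul _ _ _
    _ ≤ β • Y := smul_le_smul_of_nonneg_left hμY hβ

namespace IsRegular

variable {d : ℕ} {f : Vec d → ℝ} {μ L Lt : ℝ} (hf : IsRegular μ L Lt f)
include hf

lemma hessian_posDef (x : Vec d) : (hessian f x).PosDef :=
  posDef_of_smul_one_le hf.mu_pos (smul_one_le_hessian hf.contDiff hf.stronglyConvexSmooth x)

lemma correctionGain_nonneg : 0 ≤ correctionGain μ L Lt :=
  mul_nonneg (mul_nonneg hf.Lt_nonneg (Real.rpow_nonneg hf.mu_pos.le _)) (Real.sqrt_nonneg _)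

lemma sqrt_mul_norm_le_localNorm (x y : Vec d) : √μ * ‖y‖ ≤ localNorm f x y := by
  rw [← Real.sqrt_sq (norm_nonneg y), ← Real.sqrt_mul hf.mu_pos.le, ← quadForm_smul_one]
  exact Real.sqrt_le_sqrt
    (quadForm_le_quadForm (smul_one_le_hessian hf.contDiff hf.stronglyConvexSmooth x) _)

lemma localNorm_le_sqrt_mul_norm (x y : Vec d) : localNorm f x y ≤ √L * ‖y‖ := by
  rw [← Real.sqrt_sq (norm_nonneg y), ← Real.sqrt_mul hf.L_pos.le, ← quadForm_smul_one]
  exact Real.sqrt_le_sqrt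
    (quadForm_le_quadForm (hessian_le_smul_one hf.contDiff hf.stronglyConvexSmooth x) _)

lemma norm_sub_le_correction_mul (a b : Vec d) :
    Lt / 2 * ‖b - a‖ ≤ correction (selfConcordance μ Lt) f a b * μ := by
  have hμ := hf.mu_pos
  have hLt := hf.Lt_nonneg
  calc Lt / 2 * ‖b - a‖ = Lt / 2 * ‖b - a‖ * (μ ^ (-(3 / 2) : ℝ) * √μ * μ) := by
        rw [rpow_mul_sqrt_mul hμ, mul_one]
    _ = Lt * μ ^ (-(3 / 2) : ℝ) / 2 * (√μ * ‖b - a‖) * μ := by ring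
    _ ≤ correction (selfConcordance μ Lt) f a b * μ := by
        unfold correction
        gcongr
        exact hf.sqrt_mul_norm_le_localNorm a _

lemma correction_nonneg (a b : Vec d) : 0 ≤ correction (selfConcordance μ Lt) f a b := by
  have hμ := hf.mu_pos
  have hLt := hf.Lt_nonneg
  exact mul_nonneg (by positivity) (Real.sqrt_nonneg _)

lemma correction_le (a b : Vec d) :
    correction (selfConcordance μ Lt) f a b ≤ correctionGain μ L Lt / 2 * ‖b - a‖ := by
  have hμ := hf.mu_pos
  have hLt := hf.Lt_nonneg
  calc correction (selfConcordance μ Lt) f a b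
      ≤ Lt * μ ^ (-(3 / 2) : ℝ) / 2 * (√L * ‖b - a‖) := by
        unfold correction
        gcongr
        exact hf.localNorm_le_sqrt_mul_norm a _
    _ = correctionGain μ L Lt / 2 * ‖b - a‖ := by
        unfold correctionGain
        ring

lemma avgHessian_le {a b : Vec d} {β : ℝ} (hβ : Lt / 2 * ‖b - a‖ ≤ β * μ) :
    avgHessian f a b ≤ (1 + β) • hessian f a :=
  le_one_add_smul_of_specNorm_sub_le hf.mu_pos (avgHessian_isSymm hf.contDiff a b)
    (hessian_isSymm hf.contDiff a) (smul_one_le_hessian hf.contDiff hf.stronglyConvexSmooth a)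
    ((specNorm_avgHessian_sub_le hf.contDiff hf.hessianLipschitz a b).trans hβ)

lemma hessian_le {a b : Vec d} {β : ℝ} (hβ : Lt / 2 * ‖b - a‖ ≤ β * μ) :
    hessian f a ≤ (1 + β) • avgHessian f a b := by
  refine le_one_add_smul_of_specNorm_sub_le hf.mu_pos (hessian_isSymm hf.contDiff a)
    (avgHessian_isSymm hf.contDiff a b)
    (smul_one_le_avgHessian hf.contDiff hf.stronglyConvexSmooth a b) (le_trans (le_of_eq ?_)
      ((specNorm_avgHessian_sub_le hf.contDiff hf.hessianLipschitz a b).trans hβ))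
  rw [specNorm, specNorm, ← neg_sub, map_neg, norm_neg]

end IsRegular

namespace SharpenedUpdate

variable {d : ℕ} {f : Vec d → ℝ} {μ L Lt : ℝ} {a b : Vec d} {B B' : Mat d}

lemma hessian_le_and_sigmaErr_le (hup : SharpenedUpdate (selfConcordance μ Lt) f a b B B')
    (hf : IsRegular μ L Lt f) (hr : 0 ≤ contractionFactor d μ L) (hB : hessian f a ≤ B) :
    hessian f b ≤ B' ∧ sigmaErr B' (hessian f b) ≤ contractionFactor d μ L *
      ((1 + correction (selfConcordance μ Lt) f a b) ^ 4 * (sigmaErr B (hessian f a) + d) - d)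
    := by
  obtain ⟨β, Q, u, hβ, rfl, hu, rfl⟩ := hup
  obtain rfl : β = correction (selfConcordance μ Lt) f a b := hβ
  set β := correction (selfConcordance μ Lt) f a b
  set P := (1 + β) • avgHessian f a b with hP
  have hβ0 : 0 ≤ β := hf.correction_nonneg a b
  have hHa := hf.hessian_posDef a
  have hHb := hf.hessian_posDef b
  have hβa : Lt / 2 * ‖b - a‖ ≤ β * μ := hf.norm_sub_le_correction_mul a b
  have hβb : Lt / 2 * ‖a - b‖ ≤ β * μ := by rwa [norm_sub_rev]
  have hHaP : hessian f a ≤ P := hf.hessian_le hβa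
  have hHbP : hessian f b ≤ P := by
    rw [hP, avgHessian_comm]
    exact hf.hessian_le hβb
  have hPA : P ≤ (1 + β) ^ 2 • B := by
    rw [hP, sq, mul_smul]
    exact smul_le_smul_of_nonneg_left ((hf.avgHessian_le hβa).trans
      (smul_le_smul_of_nonneg_left hB (by positivity))) (by positivity)
  have hPHb : P ≤ (1 + β) ^ 2 • hessian f b := by
    rw [hP, avgHessian_comm, sq, mul_smul]
    exact smul_le_smul_of_nonneg_left (hf.avgHessian_le hβb) (by positivity)
  set Q := bfgs ((1 + β) ^ 2 • B) P (b - a).ofLp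
  have hHbQ : hessian f b ≤ Q :=
    hHbP.trans (le_bfgs (posDef_of_le hHa hHaP).posSemidef hPA _)
  have hQ : sigmaErr Q (hessian f b) ≤ (1 + β) ^ 4 * (sigmaErr B (hessian f a) + d) - d := by
    have htrace := trace_inv_mul_bfgs_le_mul hHa hHb hHaP hPA (by positivity) hPHb (b - a).ofLp
    rw [Matrix.mul_smul, trace_smul, smul_eq_mul] at htrace
    rw [sigmaErr_eq hHb, sigmaErr_eq hHa]
    linarith
  refine ⟨le_bfgs hHb.posSemidef hHbQ u, ?_⟩
  exact (sigmaErr_bfgs_le_of_isGreedyVector hf.L_pos hf.mu_pos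
    (smul_one_le_hessian hf.contDiff hf.stronglyConvexSmooth b)
    (hessian_le_smul_one hf.contDiff hf.stronglyConvexSmooth b) hHbQ hu).trans
    (mul_le_mul_of_nonneg_left hQ hr)

end SharpenedUpdate

end Regular

section QuasiNewton

/-- The point chosen by a step of SIQN: the minimizer of the sum of the quadratic models of the
`f i` with base points `z i` and Hessian approximations `B i`. -/
noncomputable def quasiNewtonPoint {ι : Type*} [Fintype ι] {d : ℕ} (f : ι → Vec d → ℝ)
    (z : ι → Vec d) (B : ι → Mat d) : Vec d :=
  WithLp.toLp 2 ((∑ i, B i)⁻¹ *ᵥ (∑ i, (B i *ᵥ (z i).ofLp - (gradient (f i) (z i)).ofLp)))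

variable {ι : Type*} [Fintype ι] {d : ℕ} {f : ι → Vec d → ℝ} {μ L Lt : ℝ}
  {z : ι → Vec d} {B : ι → Mat d} {x : Vec d}

lemma sum_gradient_eq_zero (hf : ∀ i, Differentiable ℝ (f i))
    (hx : ∀ y, ∑ i, f i x ≤ ∑ i, f i y) : ∑ i, gradient (f i) x = 0 := by
  have hmin : IsLocalMin (fun y => ∑ i, f i y) x := .of_forall hx
  have hfderiv := hmin.fderiv_eq_zero
  rw [fderiv_fun_sum fun i _ => hf i x] at hfderiv
  simp only [gradient, ← map_sum, hfderiv, map_zero]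

lemma quasiNewtonPoint_eq (f : ι → Vec d → ℝ) (z : ι → Vec d) (B : ι → Mat d) :
    quasiNewtonPoint f z B =
      toCLM (∑ i, B i)⁻¹ (∑ i, (toCLM (B i) (z i) - gradient (f i) (z i))) := by
  have hofLp : (∑ i, (toCLM (B i) (z i) - gradient (f i) (z i))).ofLp =
      ∑ i, (B i *ᵥ (z i).ofLp - (gradient (f i) (z i)).ofLp) := by
    simp [WithLp.ofLp_sum]
  rw [quasiNewtonPoint, ← hofLp, toEuclideanCLM_toLp]

/-- By the secant equation, the quadratic models miss the gradients at `x` only by the errors of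
the `B i` as approximations of the averaged Hessians. -/
lemma quasiNewtonPoint_sub (hf : ∀ i, ContDiff ℝ 2 (f i)) (hB : (∑ i, B i).PosDef)
    (hx : ∑ i, gradient (f i) x = 0) :
    quasiNewtonPoint f z B - x =
      toCLM (∑ i, B i)⁻¹ (∑ i, toCLM (B i - avgHessian (f i) (z i) x) (z i - x)) := by
  have hcancel : toCLM (∑ i, B i)⁻¹ (toCLM (∑ i, B i) x) = x := by
    rw [← mul_apply_eq_comp, ← map_mul, inv_mul_self_of_posDef hB, map_one, one_apply_eq_self]
  have hsecant (i : ι) : toCLM (B i - avgHessian (f i) (z i) x) (z i - x) =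
      toCLM (B i) (z i) - gradient (f i) (z i) - toCLM (B i) x + gradient (f i) x := by
    have h := toCLM_avgHessian_sub (hf i) (z i) x
    rw [← neg_sub, map_neg, neg_eq_iff_eq_neg] at h
    rw [map_sub toCLM, _root_.sub_apply, h, map_sub]
    abel
  have hsum : ∑ i, toCLM (B i - avgHessian (f i) (z i) x) (z i - x) =
      ∑ i, (toCLM (B i) (z i) - gradient (f i) (z i)) - toCLM (∑ i, B i) x := by
    simp only [hsecant, Finset.sum_add_distrib, hx, add_zero, Finset.sum_sub_distrib,
      map_sum toCLM, _root_.sum_apply]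
  rw [quasiNewtonPoint_eq, hsum, map_sub, hcancel]

lemma IsRegular.specNorm_sub_avgHessian_le {f : Vec d → ℝ} {z : Vec d} {B : Mat d}
    (hf : IsRegular μ L Lt f) (hB : hessian f z ≤ B) (x : Vec d) :
    specNorm (B - avgHessian f z x) ≤ L * sigmaErr B (hessian f z) + Lt / 2 * ‖z - x‖ := by
  have happrox : specNorm (B - hessian f z) ≤ L * sigmaErr B (hessian f z) :=
    (specNorm_le_trace (sub_nonneg.2 hB)).trans (trace_sub_le_mul_sigmaErr hf.L_pos
      (hf.hessian_posDef z) (hessian_le_smul_one hf.contDiff hf.stronglyConvexSmooth z) hB)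
  have havg := specNorm_avgHessian_sub_le hf.contDiff hf.hessianLipschitz z x
  rw [norm_sub_rev x] at havg
  calc specNorm (B - avgHessian f z x)
      = ‖toCLM (B - hessian f z) - toCLM (avgHessian f z x - hessian f z)‖ := by
        rw [← map_sub, sub_sub_sub_cancel_right, specNorm]
    _ ≤ L * sigmaErr B (hessian f z) + Lt / 2 * ‖z - x‖ := norm_sub_le_of_le happrox havg

lemma norm_quasiNewtonPoint_sub_le [Nonempty ι] (hf : ∀ i, IsRegular μ L Lt (f i))
    (hB : ∀ i, hessian (f i) (z i) ≤ B i)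
    (hx : ∑ i, gradient (f i) x = 0) {s e : ℝ} (hs : ∀ i, sigmaErr (B i) (hessian (f i) (z i)) ≤ s)
    (he : ∀ i, ‖z i - x‖ ≤ e) :
    ‖quasiNewtonPoint f z B - x‖ ≤ (L * s + Lt / 2 * e) / μ * e := by
  have hμ := (hf (Classical.arbitrary ι)).mu_pos
  have hcard : (0 : ℝ) < Fintype.card ι := by exact_mod_cast Fintype.card_pos
  have hBsum : (Fintype.card ι * μ) • (1 : Mat d) ≤ ∑ i, B i := by
    rw [← nsmul_eq_mul, smul_assoc, ← Finset.card_univ]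
    exact Finset.card_nsmul_le_sum _ _ _ fun i _ =>
      (smul_one_le_hessian (hf i).contDiff (hf i).stronglyConvexSmooth _).trans (hB i)
  have hres (i : ι) : ‖toCLM (B i - avgHessian (f i) (z i) x) (z i - x)‖ ≤
      (L * s + Lt / 2 * e) * e := by
    have hL := (hf i).L_pos
    have hLt := (hf i).Lt_nonneg
    have hbound : specNorm (B i - avgHessian (f i) (z i) x) ≤ L * s + Lt / 2 * e :=
      calc specNorm (B i - avgHessian (f i) (z i) x)
          ≤ L * sigmaErr (B i) (hessian (f i) (z i)) + Lt / 2 * ‖z i - x‖ :=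
            (hf i).specNorm_sub_avgHessian_le (hB i) x
        _ ≤ L * s + Lt / 2 * e := by
            gcongr
            exacts [hs i, he i]
    exact (toCLM _).le_of_opNorm_le_of_le hbound (he i)
  have hpos : 0 < Fintype.card ι * μ := mul_pos hcard hμ
  rw [quasiNewtonPoint_sub (fun i => (hf i).contDiff) (posDef_of_smul_one_le hpos hBsum) hx]
  calc ‖toCLM (∑ i, B i)⁻¹ (∑ i, toCLM (B i - avgHessian (f i) (z i) x) (z i - x))‖
      ≤ specNorm (∑ i, B i)⁻¹ * ‖∑ i, toCLM (B i - avgHessian (f i) (z i) x) (z i - x)‖ :=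
        ContinuousLinearMap.le_opNorm _ _
    _ ≤ (Fintype.card ι * μ)⁻¹ * (Fintype.card ι * ((L * s + Lt / 2 * e) * e)) := by
        gcongr
        · exact specNorm_inv_le hpos hBsum
        · exact (norm_sum_le_of_le _ fun i _ => hres i).trans_eq (by simp)
    _ = (L * s + Lt / 2 * e) / μ * e := by field_simp

end QuasiNewton

section Rates

lemma one_add_pow_four_le {β g : ℝ} (hβ : 0 ≤ β) (hg : β ≤ g) (hg1 : g ≤ 1) :
    (1 + β) ^ 4 ≤ 1 + 15 * g := by
  have hg0 : 0 ≤ g := hβ.trans hg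
  calc (1 + β) ^ 4 ≤ (1 + g) ^ 4 := by gcongr
    _ = 1 + g * (4 + 6 * g + 4 * g ^ 2 + g ^ 3) := by ring
    _ ≤ 1 + g * (4 + 6 * 1 + 4 * 1 ^ 2 + 1 ^ 3) := by gcongr
    _ = 1 + 15 * g := by ring

/-- The number of times a cyclic sweep over `n` indices has visited the index `i` after `t`
steps. -/
def updateCount (n t i : ℕ) : ℕ := t.count (· ≡ i [MOD n])

lemma updateCount_succ_of_eq {n t i : ℕ} (h : i = t % n) :
    updateCount n (t + 1) i = updateCount n t i + 1 :=
  Nat.count_succ_eq_succ_count (h ▸ (Nat.mod_modEq t n).symm)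

lemma updateCount_succ_of_ne {n t i : ℕ} (hi : i < n) (h : i ≠ t % n) :
    updateCount n (t + 1) i = updateCount n t i :=
  Nat.count_succ_eq_count fun hmod => h (by rw [hmod, Nat.mod_eq_of_lt hi])

lemma div_le_updateCount {n : ℕ} (hn : 0 < n) (t i : ℕ) : t / n ≤ updateCount n t i := by
  rw [updateCount, Nat.count_modEq_card t hn i]
  exact Nat.le_add_right _ _

lemma updateCount_eq_div {n t i : ℕ} (hn : 0 < n) (h : i = t % n) :
    updateCount n t i = t / n := by
  rw [updateCount, Nat.count_modEq_card t hn i, h, Nat.mod_mod, if_neg (lt_irrefl _), add_zero]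

variable {r b : ℝ}

/-- The superlinear bound, relative to the initial error, for the distance to the minimizer of a
stored point after `k` updates. -/
noncomputable def errBound (r : ℝ) (k : ℕ) : ℝ := r ^ ((k + 1) * k / 2)

/-- The linear bound, relative to the initial error, for `σ` after `k` updates of a Hessian
approximation. The factor `1 + b (1 - r ^ k)` increases from `1` to `1 + b`: it absorbs the
summable errors due to the moves of the stored point. -/
noncomputable def sigmaBound (r b : ℝ) (k : ℕ) : ℝ := r ^ k * (1 + b * (1 - r ^ k))

lemma errBound_zero (r : ℝ) : errBound r 0 = 1 := by
  simp [errBound]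

lemma errBound_succ (r : ℝ) (k : ℕ) : errBound r (k + 1) = r ^ (k + 1) * errBound r k := by
  rw [errBound, errBound, ← pow_add]
  congr 1
  rw [show (k + 1 + 1) * (k + 1) = (k + 1) * k + (k + 1) * 2 by ring,
    Nat.add_mul_div_right _ _ two_pos, add_comm]

lemma errBound_nonneg (hr : 0 ≤ r) (k : ℕ) : 0 ≤ errBound r k :=
  pow_nonneg hr _

lemma errBound_antitone (hr : 0 ≤ r) (hr1 : r ≤ 1) : Antitone (errBound r) :=
  antitone_nat_of_succ_le fun k => by
    rw [errBound_succ]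
    exact mul_le_of_le_one_left (errBound_nonneg hr k) (pow_le_one₀ hr hr1)

lemma errBound_le_one (hr : 0 ≤ r) (hr1 : r ≤ 1) (k : ℕ) : errBound r k ≤ 1 :=
  pow_le_one₀ hr hr1

lemma errBound_le_pow (hr : 0 ≤ r) (hr1 : r ≤ 1) (k : ℕ) : errBound r k ≤ r ^ k := by
  cases k with
  | zero => simp [errBound]
  | succ k =>
    rw [errBound_succ]
    exact mul_le_of_le_one_right (pow_nonneg hr _) (errBound_le_one hr hr1 k)

lemma mul_errBound_le (hr : 0 ≤ r) (hr1 : r ≤ 1) (k : ℕ) : r * errBound r k ≤ r ^ (2 * k) := by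
  cases k with
  | zero => simpa [errBound] using hr1
  | succ k =>
    calc r * errBound r (k + 1) = r * (r ^ (k + 1) * errBound r k) := by rw [errBound_succ]
      _ ≤ r * (r ^ (k + 1) * r ^ k) := by gcongr; exact errBound_le_pow hr hr1 k
      _ = r ^ (2 * (k + 1)) := by ring

lemma sigmaBound_zero (r b : ℝ) : sigmaBound r b 0 = 1 := by
  simp [sigmaBound]

lemma sigmaBound_nonneg (hr : 0 ≤ r) (hr1 : r ≤ 1) (hb : 0 ≤ b) (k : ℕ) :
    0 ≤ sigmaBound r b k := by
  have hpow : 0 ≤ 1 - r ^ k := sub_nonneg.2 (pow_le_one₀ hr hr1)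
  unfold sigmaBound
  positivity

lemma sigmaBound_le (hr : 0 ≤ r) (hr1 : r ≤ 1) (hb : 0 ≤ b) {j k : ℕ} (hjk : j ≤ k) :
    sigmaBound r b k ≤ r ^ j * (1 + b) := by
  have hpow : r ^ k ≤ r ^ j := pow_le_pow_of_le_one hr hr1 hjk
  have hfactor : b * (1 - r ^ k) ≤ b := mul_le_of_le_one_right hb (by linarith [pow_nonneg hr k])
  calc sigmaBound r b k ≤ r ^ k * (1 + b) := by
        unfold sigmaBound
        gcongr
    _ ≤ r ^ j * (1 + b) := by gcongr

lemma le_sigmaBound_succ (hr : 0 ≤ r) (hr1 : r ≤ 1) (hb : 0 ≤ b) (k : ℕ) :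
    r * (sigmaBound r b k + b * (r * (1 - r)) * errBound r k) ≤ sigmaBound r b (k + 1) := by
  have hgain : 0 ≤ b * (r * (1 - r)) := mul_nonneg hb (mul_nonneg hr (sub_nonneg.2 hr1))
  calc r * (sigmaBound r b k + b * (r * (1 - r)) * errBound r k)
      = r * sigmaBound r b k + b * (r * (1 - r)) * (r * errBound r k) := by ring
    _ ≤ r * sigmaBound r b k + b * (r * (1 - r)) * r ^ (2 * k) :=
        add_le_add_right (mul_le_mul_of_nonneg_left (mul_errBound_le hr hr1 k) hgain) _
    _ = sigmaBound r b (k + 1) := by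
        unfold sigmaBound
        ring

lemma eventually_mul_le (a : ℝ) {c : ℝ} (hc : 0 < c) : ∀ᶠ ε in 𝓝[>] 0, a * ε ≤ c := by
  have hlim : Tendsto (fun ε : ℝ => a * ε) (𝓝[>] 0) (𝓝 0) :=
    tendsto_nhdsWithin_of_tendsto_nhds ((continuous_const_mul a).tendsto' 0 0 (mul_zero a))
  exact hlim.eventually_le_const hc

end Rates

section Run

/-- The parameter `b` of `sigmaBound` for SIQN. -/
noncomputable def sigmaGain (d : ℕ) (μ L Lt : ℝ) : ℝ :=
  15 * correctionGain μ L Lt * (1 + d) /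
    (contractionFactor d μ L * (1 - contractionFactor d μ L))

/-- The radius `ε` is so small that runs of SIQN starting in the ball of radius `ε`, with the
errors `σ` of the initial approximations at most `ε`, converge superlinearly: the corrections and
the errors `σ` remain at most `1`, and already the first step contracts. -/
structure IsSmallRadius (d : ℕ) (μ L Lt ε : ℝ) : Prop where
  pos : 0 < ε
  correctionGain_mul_le : correctionGain μ L Lt * ε ≤ 1
  sigma_le : (1 + sigmaGain d μ L Lt) * ε ≤ 1
  step_le : (L * (1 + sigmaGain d μ L Lt) + Lt / 2) * ε ≤ contractionFactor d μ L * μ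

/-- The stored point `z` and the Hessian approximation `B` of `f` satisfy the bounds that are
valid after `k` updates when the run starts at distance `ε` from the minimizer `x`. -/
structure StateBound {d : ℕ} (μ L Lt ε : ℝ) (f : Vec d → ℝ) (x : Vec d) (k : ℕ) (z : Vec d)
    (B : Mat d) : Prop where
  hessian_le : hessian f z ≤ B
  sigmaErr_le : sigmaErr B (hessian f z) ≤
    ε * sigmaBound (contractionFactor d μ L) (sigmaGain d μ L Lt) k
  norm_sub_le : ‖z - x‖ ≤ ε * errBound (contractionFactor d μ L) k

variable {d : ℕ} {μ L Lt ε : ℝ}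

lemma exists_isSmallRadius (d : ℕ) (L Lt : ℝ) (hμ : 0 < μ) (hr : 0 < contractionFactor d μ L) :
    ∃ ε, IsSmallRadius d μ L Lt ε := by
  obtain ⟨ε, hpos, hgain, hsigma, hstep⟩ := (eventually_mem_nhdsWithin.and
    ((eventually_mul_le (correctionGain μ L Lt) one_pos).and
    ((eventually_mul_le (1 + sigmaGain d μ L Lt) one_pos).and
    (eventually_mul_le (L * (1 + sigmaGain d μ L Lt) + Lt / 2) (mul_pos hr hμ))))).exists
  exact ⟨ε, hpos, hgain, hsigma, hstep⟩

lemma sigmaGain_nonneg (hr : contractionFactor d μ L ∈ Ioo 0 1) (hG : 0 ≤ correctionGain μ L Lt) :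
    0 ≤ sigmaGain d μ L Lt :=
  div_nonneg (by positivity) (mul_nonneg hr.1.le (sub_nonneg.2 hr.2.le))

namespace StateBound

variable {f : Vec d → ℝ} {x z z' : Vec d} {k : ℕ} {B B' : Mat d}

lemma correction_le (h : StateBound μ L Lt ε f x k z B) (hf : IsRegular μ L Lt f)
    (hr : contractionFactor d μ L ∈ Ioo 0 1) (hε : 0 ≤ ε)
    (hz' : ‖z' - x‖ ≤ ε * errBound (contractionFactor d μ L) (k + 1)) :
    correction (selfConcordance μ Lt) f z z' ≤
      correctionGain μ L Lt * (ε * errBound (contractionFactor d μ L) k) := by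
  have hanti := errBound_antitone hr.1.le hr.2.le k.le_succ
  have hmove : ‖z' - z‖ ≤ 2 * (ε * errBound (contractionFactor d μ L) k) :=
    calc ‖z' - z‖ = ‖(z' - x) - (z - x)‖ := by rw [sub_sub_sub_cancel_right]
      _ ≤ ε * errBound (contractionFactor d μ L) k + ε * errBound (contractionFactor d μ L) k :=
        norm_sub_le_of_le (hz'.trans (mul_le_mul_of_nonneg_left hanti hε)) h.norm_sub_le
      _ = 2 * (ε * errBound (contractionFactor d μ L) k) := (two_mul _).symm
  calc correction (selfConcordance μ Lt) f z z'
      ≤ correctionGain μ L Lt / 2 * ‖z' - z‖ := hf.correction_le z z'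
    _ ≤ correctionGain μ L Lt / 2 * (2 * (ε * errBound (contractionFactor d μ L) k)) :=
      mul_le_mul_of_nonneg_left hmove (div_nonneg hf.correctionGain_nonneg zero_le_two)
    _ = correctionGain μ L Lt * (ε * errBound (contractionFactor d μ L) k) := by ring

lemma corrected_sigmaErr_le (h : StateBound μ L Lt ε f x k z B) (hf : IsRegular μ L Lt f)
    (hr : contractionFactor d μ L ∈ Ioo 0 1) (hε : IsSmallRadius d μ L Lt ε)
    (hz' : ‖z' - x‖ ≤ ε * errBound (contractionFactor d μ L) (k + 1)) :
    (1 + correction (selfConcordance μ Lt) f z z') ^ 4 * (sigmaErr B (hessian f z) + d) - d ≤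
      ε * (sigmaBound (contractionFactor d μ L) (sigmaGain d μ L Lt) k +
        15 * correctionGain μ L Lt * (1 + d) * errBound (contractionFactor d μ L) k) := by
  have hG := hf.correctionGain_nonneg
  set β := correction (selfConcordance μ Lt) f z z'
  set e := errBound (contractionFactor d μ L) k
  set s := sigmaBound (contractionFactor d μ L) (sigmaGain d μ L Lt) k
  have he0 : 0 ≤ e := errBound_nonneg hr.1.le k
  have hs0 : 0 ≤ s := sigmaBound_nonneg hr.1.le hr.2.le (sigmaGain_nonneg hr hG) k
  have hβ : β ≤ correctionGain μ L Lt * (ε * e) := h.correction_le hf hr hε.pos.le hz'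
  have hg : correctionGain μ L Lt * (ε * e) ≤ 1 :=
    calc correctionGain μ L Lt * (ε * e) = correctionGain μ L Lt * ε * e := (mul_assoc _ _ _).symm
      _ ≤ 1 := mul_le_one₀ hε.correctionGain_mul_le he0 (errBound_le_one hr.1.le hr.2.le k)
  have hs1 : ε * s ≤ 1 :=
    calc ε * s ≤ ε * (contractionFactor d μ L ^ 0 * (1 + sigmaGain d μ L Lt)) :=
          mul_le_mul_of_nonneg_left
            (sigmaBound_le hr.1.le hr.2.le (sigmaGain_nonneg hr hG) k.zero_le) hε.pos.le
      _ ≤ 1 := by rw [pow_zero, one_mul, mul_comm]; exact hε.sigma_le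
  have hpow := one_add_pow_four_le (hf.correction_nonneg z z') hβ hg
  have hε0 := hε.pos
  calc (1 + β) ^ 4 * (sigmaErr B (hessian f z) + d) - d
      ≤ (1 + β) ^ 4 * (ε * s + d) - d := by gcongr; exact h.sigmaErr_le
    _ ≤ (1 + 15 * (correctionGain μ L Lt * (ε * e))) * (ε * s + d) - d := by gcongr
    _ = ε * s + 15 * (correctionGain μ L Lt * (ε * e)) * (ε * s + d) := by ring
    _ ≤ ε * s + 15 * (correctionGain μ L Lt * (ε * e)) * (1 + d) := by gcongr
    _ = ε * (s + 15 * correctionGain μ L Lt * (1 + d) * e) := by ring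

lemma update (h : StateBound μ L Lt ε f x k z B) (hf : IsRegular μ L Lt f)
    (hr : contractionFactor d μ L ∈ Ioo 0 1) (hε : IsSmallRadius d μ L Lt ε)
    (hz' : ‖z' - x‖ ≤ ε * errBound (contractionFactor d μ L) (k + 1))
    (hup : SharpenedUpdate (selfConcordance μ Lt) f z z' B B') :
    StateBound μ L Lt ε f x (k + 1) z' B' := by
  have hgain : 15 * correctionGain μ L Lt * (1 + d) =
      sigmaGain d μ L Lt * (contractionFactor d μ L * (1 - contractionFactor d μ L)) :=
    (div_mul_cancel₀ _ (mul_pos hr.1 (sub_pos.2 hr.2)).ne').symm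
  have hb := sigmaGain_nonneg hr hf.correctionGain_nonneg
  have hcorr := h.corrected_sigmaErr_le hf hr hε hz'
  have hnext := hup.hessian_le_and_sigmaErr_le hf hr.1.le h.hessian_le
  refine ⟨hnext.1, ?_, hz'⟩
  rw [hgain] at hcorr
  set r := contractionFactor d μ L
  set b := sigmaGain d μ L Lt
  calc sigmaErr B' (hessian f z')
      ≤ r * (ε * (sigmaBound r b k + b * (r * (1 - r)) * errBound r k)) :=
        hnext.2.trans (mul_le_mul_of_nonneg_left hcorr hr.1.le)
    _ = ε * (r * (sigmaBound r b k + b * (r * (1 - r)) * errBound r k)) := mul_left_comm _ _ _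
    _ ≤ ε * sigmaBound r b (k + 1) :=
      mul_le_mul_of_nonneg_left (le_sigmaBound_succ hr.1.le hr.2.le hb k) hε.pos.le

end StateBound

lemma norm_quasiNewtonPoint_sub_le_errBound {ι : Type*} [Fintype ι] [Nonempty ι]
    {f : ι → Vec d → ℝ} {x : Vec d} {z : ι → Vec d} {B : ι → Mat d} {c : ι → ℕ} {k : ℕ}
    (hf : ∀ i, IsRegular μ L Lt (f i)) (hx : ∑ i, gradient (f i) x = 0)
    (hr : contractionFactor d μ L ∈ Ioo 0 1) (hε : IsSmallRadius d μ L Lt ε)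
    (h : ∀ i, StateBound μ L Lt ε (f i) x (c i) (z i) (B i)) (hk : ∀ i, k ≤ c i) :
    ‖quasiNewtonPoint f z B - x‖ ≤ ε * errBound (contractionFactor d μ L) (k + 1) := by
  have hf₀ := hf (Classical.arbitrary ι)
  have hμ := hf₀.mu_pos
  have hLt := hf₀.Lt_nonneg
  have hb := sigmaGain_nonneg hr hf₀.correctionGain_nonneg
  have hε0 := hε.pos.le
  have hstep := hε.step_le
  set r := contractionFactor d μ L
  set b := sigmaGain d μ L Lt
  have hs (i : ι) : sigmaErr (B i) (hessian (f i) (z i)) ≤ ε * (r ^ k * (1 + b)) :=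
    (h i).sigmaErr_le.trans
      (mul_le_mul_of_nonneg_left (sigmaBound_le hr.1.le hr.2.le hb (hk i)) hε0)
  have he (i : ι) : ‖z i - x‖ ≤ ε * errBound r k :=
    (h i).norm_sub_le.trans
      (mul_le_mul_of_nonneg_left (errBound_antitone hr.1.le hr.2.le (hk i)) hε0)
  have he0 : 0 ≤ errBound r k := errBound_nonneg hr.1.le k
  have hr0 : 0 ≤ r ^ k := pow_nonneg hr.1.le k
  calc ‖quasiNewtonPoint f z B - x‖
      ≤ (L * (ε * (r ^ k * (1 + b))) + Lt / 2 * (ε * errBound r k)) / μ * (ε * errBound r k) :=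
        norm_quasiNewtonPoint_sub_le hf (fun i => (h i).hessian_le) hx hs he
    _ ≤ (L * (ε * (r ^ k * (1 + b))) + Lt / 2 * (ε * r ^ k)) / μ * (ε * errBound r k) := by
        gcongr
        exact errBound_le_pow hr.1.le hr.2.le k
    _ = r ^ k * ((L * (1 + b) + Lt / 2) * ε) / μ * (ε * errBound r k) := by ring
    _ ≤ r ^ k * (r * μ) / μ * (ε * errBound r k) := by gcongr
    _ = ε * errBound r (k + 1) := by
        rw [errBound_succ]
        field_simp
        ring

namespace IsRun

variable {n : ℕ} {f : Fin n → Vec d → ℝ} {xstar : Vec d} {x : ℕ → Vec d}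
  {z : ℕ → Fin n → Vec d} {B : ℕ → Fin n → Mat d}

lemma stateBound_zero (hrun : IsRun (selfConcordance μ Lt) f x z B) (hx0 : ‖x 0 - xstar‖ ≤ ε)
    (hσ0 : ∀ i, sigmaErr (B 0 i) (hessian (f i) (x 0)) ≤ ε) (i : Fin n) :
    StateBound μ L Lt ε (f i) xstar 0 (z 0 i) (B 0 i) where
  hessian_le := le_iff.2 (hrun.B_init i)
  sigmaErr_le := by simpa only [hrun.z_init i, sigmaBound_zero, mul_one] using hσ0 i
  norm_sub_le := by simpa only [hrun.z_init i, errBound_zero, mul_one] using hx0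

lemma norm_sub_le_of_stateBound (hrun : IsRun (selfConcordance μ Lt) f x z B) (hn : 0 < n)
    (hf : ∀ i, IsRegular μ L Lt (f i)) (hxstar : ∑ i, gradient (f i) xstar = 0)
    (hr : contractionFactor d μ L ∈ Ioo 0 1) (hε : IsSmallRadius d μ L Lt ε) {t : ℕ}
    (h : ∀ i, StateBound μ L Lt ε (f i) xstar (updateCount n t i) (z t i) (B t i)) :
    ‖x (t + 1) - xstar‖ ≤ ε * errBound (contractionFactor d μ L) (t / n + 1) := by
  have : NeZero n := ⟨hn.ne'⟩
  rw [hrun.x_step t]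
  exact norm_quasiNewtonPoint_sub_le_errBound hf hxstar hr hε h fun i => div_le_updateCount hn t i

lemma stateBound (hrun : IsRun (selfConcordance μ Lt) f x z B) (hn : 0 < n)
    (hf : ∀ i, IsRegular μ L Lt (f i)) (hxstar : ∑ i, gradient (f i) xstar = 0)
    (hr : contractionFactor d μ L ∈ Ioo 0 1) (hε : IsSmallRadius d μ L Lt ε)
    (hx0 : ‖x 0 - xstar‖ ≤ ε) (hσ0 : ∀ i, sigmaErr (B 0 i) (hessian (f i) (x 0)) ≤ ε)
    (t : ℕ) (i : Fin n) :
    StateBound μ L Lt ε (f i) xstar (updateCount n t i) (z t i) (B t i) := by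
  induction t generalizing i with
  | zero => exact hrun.stateBound_zero hx0 hσ0 i
  | succ t ih =>
    by_cases hi : (i : ℕ) = t % n
    · rw [updateCount_succ_of_eq hi]
      refine (ih i).update (hf i) hr hε ?_ (hrun.B_active t i hi)
      rw [hrun.z_active t i hi, updateCount_eq_div hn hi]
      exact hrun.norm_sub_le_of_stateBound hn hf hxstar hr hε ih
    · rw [updateCount_succ_of_ne i.2 hi, hrun.z_other t i hi, hrun.B_other t i hi]
      exact ih i

end IsRun

end Run

end SIQN

theorem mainTheorem6 (n d : ℕ) (hn : 0 < n) (hd : 0 < d) (μ L Lt : ℝ) (hμ : 0 < μ)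
    (f : Fin n → SIQN.Vec d → ℝ)
    (hf : ∀ i, ContDiff ℝ 2 (f i))
    (hconv : ∀ i, SIQN.StronglyConvexSmooth μ L (f i))
    (hLip : ∀ i, SIQN.HessianLipschitz Lt (f i))
    (xstar : SIQN.Vec d)
    (hxstar : ∀ y, (1 / (n : ℝ)) * ∑ i, f i xstar ≤ (1 / (n : ℝ)) * ∑ i, f i y)
    (ρ : ℝ) (hρ_pos : 0 < ρ) (hρ_lt : ρ < 1 - μ / (d * L)) :
    ∃ ε σ₀ : ℝ, 0 < ε ∧ 0 < σ₀ ∧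
      ∀ (x : ℕ → SIQN.Vec d) (z : ℕ → Fin n → SIQN.Vec d) (B : ℕ → Fin n → SIQN.Mat d),
        SIQN.IsRun (Lt * μ ^ (-(3 / 2) : ℝ)) f x z B →
        ‖x 0 - xstar‖ ≤ ε →
        (∀ i, SIQN.sigmaErr (B 0 i) (SIQN.hessian (f i) (x 0)) ≤ σ₀) →
        ∃ ζ : ℕ → ℝ,
          (∀ t : ℕ, 1 ≤ t → ‖x t - xstar‖ ≤ ζ ((t - 1) / n)) ∧
          ∀ k : ℕ, ζ k ≤ ε * (1 - μ / (d * L)) ^ ((k + 2) * (k + 1) / 2) := by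
  have : Nonempty (Fin d) := ⟨⟨0, hd⟩⟩
  have hL : 0 < L := hμ.trans_le (hconv ⟨0, hn⟩).le
  have hreg (i : Fin n) : SIQN.IsRegular μ L Lt (f i) :=
    ⟨hμ, hL, (hLip i).nonneg, hf i, hconv i, hLip i⟩
  have hr : SIQN.contractionFactor d μ L ∈ Set.Ioo 0 1 :=
    ⟨hρ_pos.trans hρ_lt, sub_lt_self 1 (by positivity)⟩
  have hgrad : ∑ i, gradient (f i) xstar = 0 :=
    SIQN.sum_gradient_eq_zero (fun i => (hf i).differentiable two_ne_zero) fun y =>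
      le_of_mul_le_mul_left (hxstar y) (by positivity)
  obtain ⟨ε, hε⟩ := SIQN.exists_isSmallRadius d L Lt hμ hr.1
  refine ⟨ε, ε, hε.pos, hε.pos, fun x z B hrun hx0 hσ0 =>
    ⟨fun k => ε * SIQN.errBound (SIQN.contractionFactor d μ L) (k + 1), fun t ht => ?_,
      fun k => le_rfl⟩⟩
  obtain ⟨t, rfl⟩ := Nat.exists_eq_add_of_le' ht
  exact hrun.norm_sub_le_of_stateBound hn hreg hgrad hr hε
    (hrun.stateBound hn hreg hgrad hr hε hx0 hσ0 t)
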